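/- Let $\sigma$ be a finite relational signature in which every symbol $R$ has an arity $\mathrm{ar}(R)\ge 1$. A $\sigma$-structure $\mathbf X$ consists of a finite universe $X$ and a relation $R^{\mathbf X}\subseteq X^{\mathrm{ar}(R)}$ for each $R\in\sigma$. Its set of constraints is $\mathcal C_{\mathbf X}=\{R(\mathbf x) : R\in\sigma,\ \mathbf x\in R^{\mathbf X}\}$, and $\{\mathbf x\}$ denotes the set of entries of a tuple $\mathbf x$. **The relation $\equiv_1$.** The factor graph of $\mathbf X$ has vertex set $X\sqcup\mathcal C_{\mathbf X}$ and an edge between $x\in X$ and $R(\mathbf x)$ whenever $x\in\{\mathbf x\}$, labelled $(S,R)$ with $S=\{i : x_i=x\}$. For a vertex $v$, let $\delta_0(v)$ be one of two symbols that tell elements from constraints, and for $j\ge 1$ let $\delta_j(v)$ be the multiset $\{\{(\ell_{\{v,w\}},\delta_{j-1}(w)) : w \text{ a neighbour of } v\}\}$. Put $\delta(v)=(\delta_0(v),\delta_1(v),\dots)$. Then $\mathbf X\equiv_1\mathbf X'$ means that $\{\{\delta(v) : v\in X\sqcup \mathcal C_{\mathbf X}\}\}=\{\{\delta(v) : v\in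 X'\sqcup \mathcal C_{\mathbf X'}\}\}$. **The relation $\equiv_k$ for $k>1$.** For a tuple $\mathbf a$ and $\mathbf i=(i_1,\dots,i_n)$ write $\pi_{\mathbf i}\mathbf a=(a_{i_1},\dots,a_{i_n})$. Let $\mathbf X^*_k$ be the structure with universe $\bigsqcup_{1\le j\le k}X^j\sqcup\mathcal C_{\mathbf X}$ and relations - $T_{j,S}=\{\mathbf a\in X^j : a_i=a_{i'}\ \forall i,i'\in S\}$ for $1\le j\le k$, $S\subseteq[j]$; - $T_{j,\mathbf i}=\{(\mathbf a,\pi_{\mathbf i}\mathbf a) : \mathbf a\in X^j\}$ for $1\le j,j'\le k$, $\mathbf i\in[j]^{j'}$; - $R_S=\{R(\mathbf a) : \mathbf a\in R^{\mathbf X},\ a_i=a_{i'}\ \forall i,i'\in S\}$ for $R\in\sigma$, $S\subseteq[\mathrm{ar}(R)]$; - $R_{\mathbf i}=\{(R(\mathbf a),\pi_{\mathbf i}\mathbf a) : \mathbf a\in R^{\mathbf X}\}$ for $R\in\sigma$, $1\le j\le k$, $\mathbf i\in[\mathrm{ar}(R)]^{j}$. Then $\mathbf X\equiv_k\mathbf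 X'$ means that $\mathbf X^*_k\equiv_1\mathbf X'^*_k$. **The system $\mathrm{SA}^k(\mathbf X,\mathbf A)$.** For $\sigma$-structures $\mathbf X,\mathbf A$, it has variables $p_V(f)\in[0,1]$ for all $V\subseteq X$ with $1\le|V|\le k$ and $f:V\to A$, and $p_{R(\mathbf x)}(f)\in[0,1]$ for all $R(\mathbf x)\in\mathcal C_{\mathbf X}$ and $f:\{\mathbf x\}\to A$, subject to - $\sum_{f:V\to A}p_V(f)=1$ for all $V\subseteq X$ with $1\le |V|\le k$; - $p_U(f)=\sum_{g:V\to A,\ g|_U=f}p_V(g)$ for all $\emptyset\ne U\subseteq V\subseteq X$ with $|V|\le k$ and $f:U\to A$; - $p_U(f)=\sum_{g:\{\mathbf x\}\to A,\ g|_U=f}p_{R(\mathbf x)}(g)$ for all $R(\mathbf x)\in\mathcal C_{\mathbf X}$, $\emptyset\ne U\subseteq\{\mathbf x\}$ with $|U|\le k$ and $f:U\to A$; - $p_{R(\mathbf x)}(f)=0$ for all $R(\mathbf x)\in\mathcal C_{\mathbf X}$ and $f:\{\mathbf x\}\to A$ with $f(\mathbf x)\notin R^{\mathbf A}$. It is feasible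 if it has a rational solution. **Corollary.** Let $k\ge 1$ and let $\mathbf X$, $\mathbf X'$ be $\sigma$-structures with $\mathbf X\equiv_k\mathbf X'$. Then, for every $\sigma$-structure $\mathbf A$, $\mathrm{SA}^k(\mathbf X,\mathbf A)$ is feasible if and only if $\mathrm{SA}^k(\mathbf X',\mathbf A)$ is feasible. -/

import Mathlib

universe u v w w'

namespace CSPHierarchy

/-! ### Relational structures

A signature is a relational first-order language `L` with finitely many relation symbols, all of
positive arity; a structure over it is a finite type with an `L.Structure` instance. -/

/-- The set of constraints of a structure: the formal expressions `R(x)`, where `R` is a relation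
symbol and `x` is a tuple in the interpretation of `R`. -/
structure Constraint (L : FirstOrder.Language.{u, v}) (X : Type w) [L.Structure X] where
  arity : ℕ
  symb : L.Relations arity
  tuple : Fin arity → X
  holds : FirstOrder.Language.Structure.RelMap symb tuple

instance instFiniteConstraint (L : FirstOrder.Language.{u, v}) (X : Type w) [L.Structure X] [Finite X]
    [Finite (Σ n, L.Relations n)] : Finite (Constraint L X) := by
  let F : Constraint L X → Σ s : (Σ n, L.Relations n), (Fin s.1 → X) :=
    fun c => ⟨⟨c.arity, c.symb⟩, c.tuple⟩
  refine Finite.of_injective F ?_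
  rintro ⟨n, R, x, h⟩ ⟨n', R', x', h'⟩ e
  simp only [F, Sigma.mk.injEq] at e
  obtain ⟨⟨rfl, e₁⟩, e₂⟩ := e
  cases e₁
  cases e₂
  rfl

/-! ### Iterated degrees on the factor graph -/

/-- Edge labels `(S, R)` of the factor graph: a relation symbol `R` and a set `S` of positions. -/
abbrev EdgeLabel (L : FirstOrder.Language.{u, v}) : Type v :=
  Σ n, L.Relations n × Set (Fin n)

/-- Vertices of the factor graph: elements and constraints. An element `x` and a constraint `c`
are adjacent when `x` is an entry of the tuple of `c`; there are no other edges. -/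
abbrev FactorVertex (L : FirstOrder.Language.{u, v}) (X : Type w) [L.Structure X] : Type (max v w) :=
  X ⊕ Constraint L X

/-- The label of the edge between an element `x` and a constraint `c`: the symbol of `c` and the
set of all positions at which `x` occurs. -/
def edgeLabel {L : FirstOrder.Language.{u, v}} {X : Type w} [L.Structure X] (x : X) (c : Constraint L X) :
    EdgeLabel L :=
  ⟨c.arity, c.symb, {i | c.tuple i = x}⟩

/-- The type of `j`-th iterated degrees; it depends on the signature only, so that iterated
degrees can be compared across structures. -/
def IterDegree (L : FirstOrder.Language.{u, v}) : ℕ → Type v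
  | 0 => ULift Bool
  | j + 1 => Multiset (EdgeLabel L × IterDegree L j)

/-- The `j`-th iterated degree of a vertex of the factor graph: at level `0` one of two symbols
telling elements from constraints, at level `j + 1` the multiset of pairs (edge label, `j`-th
iterated degree) over all neighbours. -/
noncomputable def iterDegree {L : FirstOrder.Language.{u, v}} {X : Type w} [L.Structure X] [Finite X]
    [Finite (Σ n, L.Relations n)] : (j : ℕ) → FactorVertex L X → IterDegree L j
  | 0, Sum.inl _ => ULift.up false
  | 0, Sum.inr _ => ULift.up true
  | j + 1, Sum.inl x =>
      (Set.toFinite {c : Constraint L X | x ∈ Set.range c.tuple}).toFinset.val.map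
        fun c => (edgeLabel x c, iterDegree j (Sum.inr c))
  | j + 1, Sum.inr c =>
      (Set.toFinite (Set.range c.tuple)).toFinset.val.map
        fun x => (edgeLabel x c, iterDegree j (Sum.inl x))

/-- The iterated degree sequence of a structure: the multiset, over all vertices `v` of the factor
graph, of the infinite sequences `(δ₀(v), δ₁(v), δ₂(v), …)`. -/
noncomputable def degreeSequence (L : FirstOrder.Language.{u, v}) (X : Type w) [L.Structure X] [Finite X]
    [Finite (Σ n, L.Relations n)] : Multiset ((j : ℕ) → IterDegree L j) :=
  (Set.toFinite (Set.univ : Set (FactorVertex L X))).toFinset.val.map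
    fun v j => iterDegree j v

/-- The relation `≡₁`: equality of iterated degree sequences. -/
def EqWLOne (L : FirstOrder.Language.{u, v}) (X : Type w) (X' : Type w') [L.Structure X] [L.Structure X']
    [Finite X] [Finite X'] [Finite (Σ n, L.Relations n)] : Prop :=
  degreeSequence L X = degreeSequence L X'

/-! ### The operator `*ₖ`

Tuple lengths `1, …, k` are written as `j + 1` with `j : Fin k`. -/

/-- The relation symbols of the signature of `X*ₖ`: unary `T_{j,S}` and `R_S`, binary `T_{j,i}`
and `R_i`. -/
inductive StarSymbol (L : FirstOrder.Language.{u, v}) (k : ℕ) : ℕ → Type v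
  | tupleEq (j : Fin k) (S : Set (Fin (j + 1))) : StarSymbol L k 1
  | tupleProj (j j' : Fin k) (i : Fin (j' + 1) → Fin (j + 1)) : StarSymbol L k 2
  | constraintEq {n : ℕ} (R : L.Relations n) (S : Set (Fin n)) : StarSymbol L k 1
  | constraintProj {n : ℕ} (R : L.Relations n) (j : Fin k) (i : Fin (j + 1) → Fin n) :
      StarSymbol L k 2

/-- The signature of `X*ₖ`. -/
def starLanguage (L : FirstOrder.Language.{u, v}) (k : ℕ) : FirstOrder.Language.{0, v} where
  Functions := fun _ => Empty
  Relations := StarSymbol L k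

instance instFiniteStarSymbol (L : FirstOrder.Language.{u, v}) (k : ℕ) [Finite (Σ n, L.Relations n)] :
    Finite (Σ n, (starLanguage L k).Relations n) := by
  let F : ((Σ j : Fin k, Set (Fin (j + 1))) ⊕
      (Σ p : Fin k × Fin k, (Fin (p.2 + 1) → Fin (p.1 + 1)))) ⊕
      ((Σ R : (Σ n, L.Relations n), Set (Fin R.1)) ⊕
      (Σ p : (Σ n, L.Relations n) × Fin k, (Fin (p.2 + 1) → Fin p.1.1))) →
      Σ n, (starLanguage L k).Relations n := fun s =>
    match s with
    | Sum.inl (Sum.inl ⟨j, S⟩) => ⟨1, StarSymbol.tupleEq j S⟩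
    | Sum.inl (Sum.inr ⟨p, i⟩) => ⟨2, StarSymbol.tupleProj p.1 p.2 i⟩
    | Sum.inr (Sum.inl ⟨R, S⟩) => ⟨1, StarSymbol.constraintEq R.2 S⟩
    | Sum.inr (Sum.inr ⟨p, i⟩) => ⟨2, StarSymbol.constraintProj p.1.2 p.2 i⟩
  refine Finite.of_surjective F ?_
  rintro ⟨n, s⟩
  cases s with
  | tupleEq j S => exact ⟨Sum.inl (Sum.inl ⟨j, S⟩), rfl⟩
  | tupleProj j j' i => exact ⟨Sum.inl (Sum.inr ⟨(j, j'), i⟩), rfl⟩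
  | @constraintEq n R S => exact ⟨Sum.inr (Sum.inl ⟨⟨n, R⟩, S⟩), rfl⟩
  | @constraintProj n R j i => exact ⟨Sum.inr (Sum.inr ⟨(⟨n, R⟩, j), i⟩), rfl⟩

/-- The universe of `X*ₖ`: tuples of length at least `1` and at most `k`, and constraints. -/
def Star (L : FirstOrder.Language.{u, v}) (k : ℕ) (X : Type w) [L.Structure X] : Type (max v w) :=
  (Σ j : Fin k, (Fin (j + 1) → X)) ⊕ Constraint L X

instance instFiniteStar (L : FirstOrder.Language.{u, v}) (k : ℕ) (X : Type w) [L.Structure X] [Finite X]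
    [Finite (Σ n, L.Relations n)] : Finite (Star L k X) :=
  inferInstanceAs (Finite ((Σ j : Fin k, (Fin (j + 1) → X)) ⊕ Constraint L X))

/-- The interpretation of the relation symbols in `X*ₖ`. -/
def starRel (L : FirstOrder.Language.{u, v}) (k : ℕ) (X : Type w) [L.Structure X] :
    {m : ℕ} → StarSymbol L k m → (Fin m → Star L k X) → Prop
  | _, StarSymbol.tupleEq j S, t =>
      ∃ x : Fin (j + 1) → X, (∀ i ∈ S, ∀ i' ∈ S, x i = x i') ∧ t 0 = Sum.inl ⟨j, x⟩
  | _, StarSymbol.tupleProj j j' i, t =>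
      ∃ x : Fin (j + 1) → X, t 0 = Sum.inl ⟨j, x⟩ ∧ t 1 = Sum.inl ⟨j', x ∘ i⟩
  | _, @StarSymbol.constraintEq _ _ n R S, t =>
      ∃ (x : Fin n → X) (h : FirstOrder.Language.Structure.RelMap R x),
        (∀ i ∈ S, ∀ i' ∈ S, x i = x i') ∧ t 0 = Sum.inr ⟨n, R, x, h⟩
  | _, @StarSymbol.constraintProj _ _ n R j i, t =>
      ∃ (x : Fin n → X) (h : FirstOrder.Language.Structure.RelMap R x),
        t 0 = Sum.inr ⟨n, R, x, h⟩ ∧ t 1 = Sum.inl ⟨j, x ∘ i⟩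

instance instStructureStar (L : FirstOrder.Language.{u, v}) (k : ℕ) (X : Type w) [L.Structure X] :
    (starLanguage L k).Structure (Star L k X) where
  funMap := fun f _ => Empty.elim f
  RelMap := fun R t => starRel L k X R t

/-- The relation `≡ₖ`, for `k ≥ 1`: for `k = 1` it is `≡₁`, and for `k > 1` it is `≡₁` between the
structures `X*ₖ` and `X'*ₖ`. -/
def EqWL (L : FirstOrder.Language.{u, v}) (k : ℕ) (X : Type w) (X' : Type w') [L.Structure X]
    [L.Structure X'] [Finite X] [Finite X'] [Finite (Σ n, L.Relations n)] : Prop :=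
  (k = 1 ∧ EqWLOne L X X') ∨
    (1 < k ∧ EqWLOne (starLanguage L k) (Star L k X) (Star L k X'))

/-! ### The Sherali–Adams system -/

open Classical in
/-- The set of entries of the tuple of a constraint. -/
noncomputable def Constraint.vars {L : FirstOrder.Language.{u, v}} {X : Type w} [L.Structure X]
    (c : Constraint L X) : Finset X :=
  Finset.univ.image c.tuple

theorem Constraint.tuple_mem_vars {L : FirstOrder.Language.{u, v}} {X : Type w} [L.Structure X]
    (c : Constraint L X) (i : Fin c.arity) : c.tuple i ∈ c.vars := by
  classical
  simp [Constraint.vars]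

/-- Restriction of `g : V → A` to `U ⊆ V`. -/
def restrictFun {X : Type w} {A : Type w'} {U V : Finset X} (h : U ⊆ V) (g : V → A) : U → A :=
  fun x => g ⟨x.1, h x.2⟩

open Classical in
/-- `IsSASolution k p q`: the rational numbers `p V f` (for `V ⊆ X` with `1 ≤ |V| ≤ k` and
`f : V → A`; other values of `p` play no role) and `q c f` (for a constraint `c` of `X` and a map
`f` from the entries of `c` to `A`) solve the system `SAᵏ(X, A)`. -/
structure IsSASolution {L : FirstOrder.Language.{u, v}} {X : Type w} {A : Type w'} [L.Structure X]
    [L.Structure A] [Fintype A] (k : ℕ) (p : (V : Finset X) → (V → A) → ℚ)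
    (q : (c : Constraint L X) → (c.vars → A) → ℚ) : Prop where
  p_range : ∀ V : Finset X, V.Nonempty → V.card ≤ k → ∀ f : V → A, p V f ∈ Set.Icc (0 : ℚ) 1
  q_range : ∀ (c : Constraint L X) (f : c.vars → A), q c f ∈ Set.Icc (0 : ℚ) 1
  sum_one : ∀ V : Finset X, V.Nonempty → V.card ≤ k → ∑ f : V → A, p V f = 1
  marginal : ∀ (U V : Finset X) (h : U ⊆ V), U.Nonempty → V.card ≤ k → ∀ f : U → A,
    p U f = ∑ g : V → A with restrictFun h g = f, p V g
  constraint_marginal : ∀ (c : Constraint L X) (U : Finset X) (h : U ⊆ c.vars), U.Nonempty →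
    U.card ≤ k → ∀ f : U → A, p U f = ∑ g : c.vars → A with restrictFun h g = f, q c g
  constraint_support : ∀ (c : Constraint L X) (f : c.vars → A),
    ¬ FirstOrder.Language.Structure.RelMap c.symb (fun i => f ⟨c.tuple i, c.tuple_mem_vars i⟩) → q c f = 0

/-- `SAᵏ(X, A)` is feasible: it has a rational solution. -/
def SAFeasible (L : FirstOrder.Language.{u, v}) (k : ℕ) (X : Type w) (A : Type w') [L.Structure X]
    [L.Structure A] [Fintype A] : Prop :=
  ∃ (p : (V : Finset X) → (V → A) → ℚ) (q : (c : Constraint L X) → (c.vars → A) → ℚ),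
    IsSASolution k p q

end CSPHierarchy

namespace CSPHierarchy

open FirstOrder.Language (Structure)

theorem edgeLabel_eq_mk {L : FirstOrder.Language.{u, v}} {Y : Type w} [L.Structure Y]
    {Y' : Type w'} [L.Structure Y'] {y : Y} {c : Constraint L Y} {n : ℕ} {R : L.Relations n}
    {t' : Fin n → Y'} {h' : Structure.RelMap R t'} {y' : Y'}
    (h : edgeLabel y c = edgeLabel y' ⟨n, R, t', h'⟩) :
    ∃ (t : Fin n → Y) (ht : Structure.RelMap R t), c = ⟨n, R, t, ht⟩ ∧
      ∀ i, t i = y ↔ t' i = y' := by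
  obtain ⟨m, Q, t, ht⟩ := c
  simp only [edgeLabel, Sigma.mk.injEq] at h
  obtain ⟨rfl, h⟩ := h
  simp only [heq_eq_eq, Prod.mk.injEq] at h
  obtain ⟨rfl, h⟩ := h
  exact ⟨t, ht, rfl, fun i => Set.ext_iff.1 h i⟩

section IteratedDegree

variable {L : FirstOrder.Language.{u, v}} [Finite (Σ n, L.Relations n)]
  {Y : Type w} [L.Structure Y] [Finite Y] {Y' : Type w'} [L.Structure Y'] [Finite Y']

/-- Two vertices of factor graphs with the same sequence of iterated degrees. -/
def SameDegree (v : FactorVertex L Y) (v' : FactorVertex L Y') : Prop :=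
  ∀ j, iterDegree j v = iterDegree j v'

theorem SameDegree.symm {v : FactorVertex L Y} {v' : FactorVertex L Y'} (h : SameDegree v v') :
    SameDegree v' v := fun j => (h j).symm

theorem SameDegree.trans {Y'' : Type*} [L.Structure Y''] [Finite Y''] {v : FactorVertex L Y}
    {v' : FactorVertex L Y'} {v'' : FactorVertex L Y''} (h : SameDegree v v')
    (h' : SameDegree v' v'') : SameDegree v v'' := fun j => (h j).trans (h' j)

theorem EqWLOne.symm (h : EqWLOne L Y Y') : EqWLOne L Y' Y := Eq.symm h

theorem EqWLOne.exists_sameDegree (h : EqWLOne L Y Y') (v' : FactorVertex L Y') :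
    ∃ v : FactorVertex L Y, SameDegree v v' := by
  have hm : (fun j => iterDegree j v') ∈ degreeSequence L Y' :=
    Multiset.mem_map.2 ⟨v', by simp, rfl⟩
  rw [← show degreeSequence L Y = degreeSequence L Y' from h] at hm
  obtain ⟨v, -, hv⟩ := Multiset.mem_map.1 hm
  exact ⟨v, fun j => congrFun hv j⟩

theorem EqWLOne.exists_sameDegree_inl (h : EqWLOne L Y Y') (y' : Y') :
    ∃ y : Y, SameDegree (L := L) (Sum.inl y) (Sum.inl y') := by
  obtain ⟨y | c, hv⟩ := h.exists_sameDegree (Sum.inl y')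
  · exact ⟨y, hv⟩
  · exact absurd (congrArg ULift.down (hv 0)) (by simp [iterDegree])

theorem EqWLOne.exists_sameDegree_inr (h : EqWLOne L Y Y') (c' : Constraint L Y') :
    ∃ c : Constraint L Y, SameDegree (Sum.inr c) (Sum.inr c') := by
  obtain ⟨y | c, hv⟩ := h.exists_sameDegree (Sum.inr c')
  · exact absurd (congrArg ULift.down (hv 0)) (by simp [iterDegree])
  · exact ⟨c, hv⟩

theorem exists_constraint_of_iterDegree_eq {j : ℕ} {y : Y} {y' : Y'}
    (h : iterDegree (L := L) (j + 1) (Sum.inl y) = iterDegree (j + 1) (Sum.inl y')) {n : ℕ}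
    (R : L.Relations n) (t' : Fin n → Y') (h' : Structure.RelMap R t') {i : Fin n}
    (hi : t' i = y') :
    ∃ (t : Fin n → Y) (ht : Structure.RelMap R t), (∀ i, t i = y ↔ t' i = y') ∧
      iterDegree j (Sum.inr ⟨n, R, t, ht⟩) = iterDegree j (Sum.inr ⟨n, R, t', h'⟩) := by
  obtain ⟨c, -, hc⟩ := Multiset.exists_mem_of_rel_of_mem
    (Multiset.rel_map.1 (Multiset.rel_eq.2 h.symm)) (a := ⟨n, R, t', h'⟩) (by simpa using ⟨i, hi⟩)
  obtain ⟨hl, hd⟩ := Prod.mk.inj hc.symm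
  obtain ⟨t, ht, rfl, hk⟩ := edgeLabel_eq_mk hl
  exact ⟨t, ht, hk, hd⟩

theorem exists_entry_of_iterDegree_eq {j : ℕ} {c : Constraint L Y} {n : ℕ} {R : L.Relations n}
    {t' : Fin n → Y'} {h' : Structure.RelMap R t'}
    (h : iterDegree (j + 1) (Sum.inr c) = iterDegree (j + 1) (Sum.inr ⟨n, R, t', h'⟩))
    (i : Fin n) :
    ∃ (t : Fin n → Y) (ht : Structure.RelMap R t), c = ⟨n, R, t, ht⟩ ∧
      (∀ i', t i' = t i ↔ t' i' = t' i) ∧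
      iterDegree (L := L) j (Sum.inl (t i)) = iterDegree j (Sum.inl (t' i)) := by
  obtain ⟨y, -, hc⟩ := Multiset.exists_mem_of_rel_of_mem
    (Multiset.rel_map.1 (Multiset.rel_eq.2 h.symm)) (a := t' i) (by simp)
  obtain ⟨hl, hd⟩ := Prod.mk.inj hc.symm
  obtain ⟨t, ht, rfl, hk⟩ := edgeLabel_eq_mk hl
  obtain rfl : t i = y := (hk i).2 rfl
  exact ⟨t, ht, rfl, hk, hd⟩

theorem SameDegree.exists_eq_mk {c : Constraint L Y} {n : ℕ} {R : L.Relations n}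
    {t' : Fin n → Y'} {h' : Structure.RelMap R t'}
    (h : SameDegree (Sum.inr c) (Sum.inr ⟨n, R, t', h'⟩)) (i : Fin n) :
    ∃ (t : Fin n → Y) (ht : Structure.RelMap R t), c = ⟨n, R, t, ht⟩ := by
  obtain ⟨t, ht, rfl, -⟩ := exists_entry_of_iterDegree_eq (h 1) i
  exact ⟨t, ht, rfl⟩

theorem SameDegree.entry {n : ℕ} {R : L.Relations n} {t : Fin n → Y} {ht : Structure.RelMap R t}
    {t' : Fin n → Y'} {ht' : Structure.RelMap R t'}
    (h : SameDegree (Sum.inr ⟨n, R, t, ht⟩) (Sum.inr ⟨n, R, t', ht'⟩)) (i : Fin n) :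
    SameDegree (L := L) (Sum.inl (t i)) (Sum.inl (t' i)) := by
  intro j
  obtain ⟨s, hs, he, -, hd⟩ := exists_entry_of_iterDegree_eq (h (j + 1)) i
  cases he
  exact hd

theorem SameDegree.entry_eq_iff {n : ℕ} {R : L.Relations n} {t : Fin n → Y}
    {ht : Structure.RelMap R t} {t' : Fin n → Y'} {ht' : Structure.RelMap R t'}
    (h : SameDegree (Sum.inr ⟨n, R, t, ht⟩) (Sum.inr ⟨n, R, t', ht'⟩)) (i i' : Fin n) :
    t i = t i' ↔ t' i = t' i' := by
  obtain ⟨s, hs, he, hk, -⟩ := exists_entry_of_iterDegree_eq (h 1) i'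
  cases he
  exact hk i

theorem iterDegree_succ_eq (j : ℕ) :
    (∀ y y' : Y, iterDegree (L := L) (j + 1) (Sum.inl y) = iterDegree (j + 1) (Sum.inl y') →
      iterDegree (L := L) j (Sum.inl y) = iterDegree j (Sum.inl y')) ∧
    (∀ c c' : Constraint L Y, iterDegree (j + 1) (Sum.inr c) = iterDegree (j + 1) (Sum.inr c') →
      iterDegree j (Sum.inr c) = iterDegree j (Sum.inr c')) := by
  induction j with
  | zero => exact ⟨fun _ _ _ => rfl, fun _ _ _ => rfl⟩
  | succ j ih =>
    constructor
    · intro y y' h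
      have h' := Multiset.rel_map.1 (Multiset.rel_eq.2 h)
      refine Multiset.rel_eq.1 (Multiset.rel_map.2 (h'.mono fun c _ c' _ hc => ?_))
      obtain ⟨h₁, h₂⟩ := Prod.mk.inj hc
      exact Prod.ext h₁ (ih.2 _ _ h₂)
    · intro c c' h
      have h' := Multiset.rel_map.1 (Multiset.rel_eq.2 h)
      refine Multiset.rel_eq.1 (Multiset.rel_map.2 (h'.mono fun y _ y' _ hc => ?_))
      obtain ⟨h₁, h₂⟩ := Prod.mk.inj hc
      exact Prod.ext h₁ (ih.1 _ _ h₂)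

theorem iterDegree_eq_of_le {j J : ℕ} (hj : j ≤ J) {c c' : Constraint L Y}
    (h : iterDegree J (Sum.inr c) = iterDegree J (Sum.inr c')) :
    iterDegree j (Sum.inr c) = iterDegree j (Sum.inr c') := by
  induction J, hj using Nat.le_induction with
  | base => exact h
  | succ J _ ih => exact ih ((iterDegree_succ_eq J).2 _ _ h)

variable (L Y) in
/-- At some finite level the iterated degrees of the constraints have stabilised. -/
theorem exists_stable_level : ∃ J : ℕ, ∀ c c' : Constraint L Y,
    iterDegree J (Sum.inr c) = iterDegree J (Sum.inr c') → SameDegree (Sum.inr c) (Sum.inr c') := by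
  have : ∀ᶠ J in Filter.atTop, ∀ c c' : Constraint L Y,
      iterDegree J (Sum.inr c) = iterDegree J (Sum.inr c') →
        SameDegree (Sum.inr c) (Sum.inr c') := by
    refine Filter.eventually_all.2 fun c => Filter.eventually_all.2 fun c' => ?_
    by_cases hc : SameDegree (Sum.inr c) (Sum.inr c')
    · exact Filter.Eventually.of_forall fun _ _ => hc
    · obtain ⟨j, hj⟩ := not_forall.1 hc
      filter_upwards [Filter.eventually_ge_atTop j] with J hJ h
      exact absurd (iterDegree_eq_of_le hJ h) hj
  exact this.exists

theorem SameDegree.ncard_eq {y₁ y₂ : Y} (h : SameDegree (L := L) (Sum.inl y₁) (Sum.inl y₂)) {n : ℕ}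
    (R : L.Relations n) (i : Fin n) (Q : (Fin n → Y) → Prop)
    (hQ : ∀ t₁ t₂ (h₁ : Structure.RelMap R t₁) (h₂ : Structure.RelMap R t₂),
      SameDegree (Sum.inr ⟨n, R, t₁, h₁⟩) (Sum.inr ⟨n, R, t₂, h₂⟩) → Q t₁ → Q t₂) :
    {t | Structure.RelMap R t ∧ t i = y₁ ∧ Q t}.ncard =
      {t | Structure.RelMap R t ∧ t i = y₂ ∧ Q t}.ncard := by
  classical
  obtain ⟨J, hJ⟩ := exists_stable_level L Y
  let g : EdgeLabel L × IterDegree L J → Prop := fun l =>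
    ∃ S : Set (Fin n), i ∈ S ∧ l.1 = ⟨n, R, S⟩ ∧
      ∃ t, ∃ ht : Structure.RelMap R t, iterDegree J (Sum.inr ⟨n, R, t, ht⟩) = l.2 ∧ Q t
  have key : ∀ y : Y, {t | Structure.RelMap R t ∧ t i = y ∧ Q t}.ncard =
      Multiset.countP g (iterDegree (L := L) (J + 1) (Sum.inl y)) := by
    intro y
    rw [iterDegree, Multiset.countP_map, ← Finset.filter_val, Finset.card_val,
      ← Set.ncard_coe_finset]
    refine Set.ncard_congr (fun t ht => ⟨n, R, t, ht.1⟩) ?_ ?_ ?_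
    · rintro t ⟨ht, hi, hq⟩
      simp only [Finset.coe_filter, Set.Finite.mem_toFinset, Set.mem_ofPred_eq]
      exact ⟨⟨i, hi⟩, _, hi, rfl, t, ht, rfl, hq⟩
    · intro t t' ht ht' he
      cases he
      rfl
    · intro c hc
      simp only [Finset.coe_filter, Set.Finite.mem_toFinset, Set.mem_ofPred_eq] at hc
      obtain ⟨-, S, hiS, hl, t, ht, hd, hq⟩ := hc
      obtain ⟨m, R', s, hs⟩ := c
      simp only [edgeLabel, Sigma.mk.injEq] at hl
      obtain ⟨rfl, hl⟩ := hl
      simp only [heq_eq_eq, Prod.mk.injEq] at hl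
      obtain ⟨rfl, rfl⟩ := hl
      exact ⟨s, ⟨hs, hiS, hQ _ _ _ _ (hJ _ _ hd) hq⟩, rfl⟩
  rw [key, key, h (J + 1)]

end IteratedDegree

section Average

variable {α β : Type*} [Finite α] [Finite β]

/-- The average of `F` over a set of elements of a finite type. -/
noncomputable def average (s : Set α) (F : α → ℚ) : ℚ :=
  (∑ a ∈ s.toFinite.toFinset, F a) / s.ncard

theorem average_mem_Icc {s : Set α} {F : α → ℚ} (hF : ∀ a ∈ s, F a ∈ Set.Icc (0 : ℚ) 1) :
    average s F ∈ Set.Icc (0 : ℚ) 1 := by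
  refine ⟨div_nonneg (Finset.sum_nonneg fun a ha => (hF a (by simpa using ha)).1) (by positivity),
    div_le_one_of_le₀ ?_ (by positivity)⟩
  rw [Set.ncard_eq_toFinset_card s, Finset.cast_card]
  exact Finset.sum_le_sum fun a ha => (hF a (by simpa using ha)).2

theorem average_congr {s : Set α} {F G : α → ℚ} (h : ∀ a ∈ s, F a = G a) :
    average s F = average s G := by
  unfold average
  rw [Finset.sum_congr rfl fun a ha => h a (by simpa using ha)]

theorem average_eq_of_forall {s : Set α} (hs : s.Nonempty) {F : α → ℚ} {r : ℚ}
    (h : ∀ a ∈ s, F a = r) : average s F = r := by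
  have : (s.ncard : ℚ) ≠ 0 := by
    rw [Nat.cast_ne_zero, Ne, Set.ncard_eq_zero]
    exact hs.ne_empty
  rw [average_congr h, average, Finset.sum_const, ← Set.ncard_eq_toFinset_card s, nsmul_eq_mul,
    mul_div_cancel_left₀ _ this]

theorem sum_average {ι : Type*} (T : Finset ι) (s : Set α) (F : ι → α → ℚ) :
    ∑ i ∈ T, average s (F i) = average s fun a => ∑ i ∈ T, F i a := by
  simp only [average]
  rw [← Finset.sum_div, Finset.sum_comm]

/-- Averaging over `s` a function of `π a` is averaging over `t`, if all fibres of `π : s → t` have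
the same size. -/
theorem average_comp {s : Set α} {t : Set β} (hs : s.Nonempty) (π : α → β)
    (hπ : ∀ a ∈ s, π a ∈ t)
    (hc : ∀ b₁ ∈ t, ∀ b₂ ∈ t, {a | a ∈ s ∧ π a = b₁}.ncard = {a | a ∈ s ∧ π a = b₂}.ncard)
    (F : β → ℚ) : average s (fun a => F (π a)) = average t F := by
  classical
  obtain ⟨a₀, ha₀⟩ := hs
  set m := {a | a ∈ s ∧ π a = π a₀}.ncard with hm
  have hm0 : (m : ℚ) ≠ 0 := by
    have : m ≠ 0 := Set.ncard_ne_zero_of_mem (a := a₀) ⟨ha₀, rfl⟩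
    exact_mod_cast this
  have key : ∀ G : β → ℚ, ∑ a ∈ s.toFinite.toFinset, G (π a) =
      m * ∑ b ∈ t.toFinite.toFinset, G b := by
    intro G
    rw [← Finset.sum_fiberwise_of_maps_to (t := t.toFinite.toFinset) (g := π)
      (fun a ha => by simpa using hπ a (by simpa using ha)), Finset.mul_sum]
    refine Finset.sum_congr rfl fun b hb => ?_
    rw [Finset.sum_congr rfl (g := fun _ => G b)
      (fun a ha => by rw [(Finset.mem_filter.1 ha).2]), Finset.sum_const, nsmul_eq_mul]
    congr 2
    rw [hm, hc _ (hπ a₀ ha₀) b (by simpa using hb), ← Set.ncard_coe_finset]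
    simp
  have hcard : (s.ncard : ℚ) = m * t.ncard := by
    have := key fun _ => 1
    simpa [← Set.ncard_eq_toFinset_card] using this
  rw [average, average, key, hcard, mul_div_mul_left _ _ hm0]

end Average

section Pushforward

variable {α β γ : Type*} [Fintype α]

open Classical in
/-- The pushforward of a weight function. -/
noncomputable def pushforward (φ : α → β) (w : α → ℚ) (b : β) : ℚ :=
  ∑ a with φ a = b, w a

theorem pushforward_pushforward [Fintype β] (φ : α → β) (ψ : β → γ) (w : α → ℚ) :
    pushforward ψ (pushforward φ w) = pushforward (ψ ∘ φ) w := by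
  classical
  funext c
  simp only [pushforward]
  rw [← Finset.sum_fiberwise_of_maps_to (s := {a | (ψ ∘ φ) a = c}) (t := {b | ψ b = c})
    (g := φ) (by simp)]
  refine Finset.sum_congr rfl fun b hb => Finset.sum_congr ?_ fun _ _ => rfl
  ext a
  simp only [Finset.mem_filter, Finset.mem_univ, true_and, Function.comp] at hb ⊢
  constructor
  · rintro rfl
    exact ⟨hb, rfl⟩
  · exact fun h => h.2

theorem exists_of_pushforward_ne_zero {φ : α → β} {w : α → ℚ} {b : β}
    (h : pushforward φ w b ≠ 0) : ∃ a, φ a = b ∧ w a ≠ 0 := by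
  obtain ⟨a, ha, hw⟩ := Finset.exists_ne_zero_of_sum_ne_zero h
  exact ⟨a, by simpa using ha, hw⟩

theorem pushforward_nonneg {φ : α → β} {w : α → ℚ} (hw : ∀ a, 0 ≤ w a) (b : β) :
    0 ≤ pushforward φ w b := Finset.sum_nonneg fun a _ => hw a

theorem sum_pushforward [Fintype β] (φ : α → β) (w : α → ℚ) : ∑ b, pushforward φ w b = ∑ a, w a := by
  classical
  exact Finset.sum_fiberwise Finset.univ φ w

/-- If `w` vanishes off the image of the injective map `φ`, then summing `w ∘ φ` over a fibre of
`ψ` is summing `w` over the corresponding fibre of `χ`. -/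
theorem sum_comp_eq_pushforward [Fintype β] {δ : Type*} {φ : α → β} (hφ : Function.Injective φ) {w : β → ℚ}
    (hw : ∀ b, w b ≠ 0 → b ∈ Set.range φ) (χ : β → δ) (d : δ) (P : α → Prop) [DecidablePred P]
    (hP : ∀ a, P a ↔ χ (φ a) = d) : ∑ a with P a, w (φ a) = pushforward χ w d := by
  classical
  refine Finset.sum_of_injOn φ hφ.injOn ?_ ?_ fun _ _ => rfl
  · intro a ha
    simpa [hP] using ha
  · intro b hb hb'
    by_contra hne
    obtain ⟨a, rfl⟩ := hw b hne
    exact hb' ⟨a, by simpa [hP] using hb, rfl⟩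

end Pushforward

section Transfer

open scoped Classical

variable {L : FirstOrder.Language.{u, v}} {X : Type*} {X' : Type*} {A : Type*}
  [L.Structure X] [L.Structure X'] [L.Structure A]

/-- Families of sets of tuples of `X`, indexed by the tuples of length at most `k` and the
constraints of `X'`, along which solutions of `SAᵏ` can be averaged. -/
structure TupleClasses (L : FirstOrder.Language.{u, v}) (k : ℕ) (X X' : Type*) [L.Structure X]
    [L.Structure X'] where
  tuples (j : Fin k) (a' : Fin (j + 1) → X') : Set (Fin (j + 1) → X)
  constraints (c' : Constraint L X') : Set (Fin c'.arity → X)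
  tuples_nonempty (j : Fin k) (a' : Fin (j + 1) → X') : (tuples j a').Nonempty
  constraints_nonempty (c' : Constraint L X') : (constraints c').Nonempty
  tuples_eq (j : Fin k) (a' : Fin (j + 1) → X') (a) (ha : a ∈ tuples j a') (i i' : Fin (j + 1)) :
    a' i = a' i' → a i = a i'
  constraints_eq (c' : Constraint L X') (t) (ht : t ∈ constraints c') (i i' : Fin c'.arity) :
    c'.tuple i = c'.tuple i' → t i = t i'
  constraints_holds (c' : Constraint L X') (t) (ht : t ∈ constraints c') :
    Structure.RelMap c'.symb t
  tuples_comp (j j' : Fin k) (a' : Fin (j + 1) → X') (a) (ha : a ∈ tuples j a')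
    (i : Fin (j' + 1) → Fin (j + 1)) : a ∘ i ∈ tuples j' (a' ∘ i)
  constraints_comp (c' : Constraint L X') (j : Fin k) (t) (ht : t ∈ constraints c')
    (i : Fin (j + 1) → Fin c'.arity) : t ∘ i ∈ tuples j (c'.tuple ∘ i)
  tuples_fibre (j j' : Fin k) (a' : Fin (j + 1) → X') (i : Fin (j' + 1) → Fin (j + 1)) (b₁ b₂)
    (h₁ : b₁ ∈ tuples j' (a' ∘ i)) (h₂ : b₂ ∈ tuples j' (a' ∘ i)) :
    {a | a ∈ tuples j a' ∧ a ∘ i = b₁}.ncard = {a | a ∈ tuples j a' ∧ a ∘ i = b₂}.ncard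
  constraints_fibre (c' : Constraint L X') (j : Fin k) (i : Fin (j + 1) → Fin c'.arity) (b₁ b₂)
    (h₁ : b₁ ∈ tuples j (c'.tuple ∘ i)) (h₂ : b₂ ∈ tuples j (c'.tuple ∘ i)) :
    {t | t ∈ constraints c' ∧ t ∘ i = b₁}.ncard = {t | t ∈ constraints c' ∧ t ∘ i = b₂}.ncard

/-- The set of entries of a tuple. -/
noncomputable def entries {n : ℕ} (a : Fin n → X) : Finset X := Finset.univ.image a

theorem mem_entries {n : ℕ} {a : Fin n → X} {x : X} : x ∈ entries a ↔ ∃ i, a i = x := by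
  simp [entries]

theorem entries_tuple (c : Constraint L X) : entries c.tuple = c.vars := rfl

/-- Evaluation along a tuple of a map defined on a set that contains the entries of the tuple. -/
def evalTuple {n : ℕ} {V : Finset X} (a : Fin n → X) (h : entries a ⊆ V) (g : V → A) : Fin n → A :=
  fun i => g ⟨a i, h (mem_entries.2 ⟨i, rfl⟩)⟩

theorem evalTuple_injective {n : ℕ} {V : Finset X} {a : Fin n → X} (h : entries a = V) :
    Function.Injective (evalTuple (A := A) a h.subset) := by
  subst h
  intro g g' hg
  funext ⟨x, hx⟩
  obtain ⟨i, rfl⟩ := mem_entries.1 hx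
  exact congrFun hg i

theorem mem_range_evalTuple {n : ℕ} {V : Finset X} {a : Fin n → X} (h : entries a = V)
    {f : Fin n → A} (hf : ∀ i i', a i = a i' → f i = f i') :
    f ∈ Set.range (evalTuple (A := A) a h.subset) := by
  subst h
  choose e he using fun x : entries a => mem_entries.1 x.2
  exact ⟨fun x => f (e x), funext fun i => hf _ _ (he _)⟩

theorem exists_entries_eq {k : ℕ} {V : Finset X} (hV : V.Nonempty) (hk : V.card ≤ k) :
    ∃ (j : Fin k) (a : Fin (j + 1) → X), entries a = V := by
  have hpos := hV.card_pos
  refine ⟨⟨V.card - 1, by omega⟩,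
    fun i => (V.equivFin.symm (Fin.cast (Nat.sub_add_cancel hpos) i)).1, ?_⟩
  ext x
  rw [mem_entries]
  constructor
  · rintro ⟨i, rfl⟩
    exact Subtype.prop _
  · intro hx
    exact ⟨Fin.cast (Nat.sub_add_cancel hpos).symm (V.equivFin ⟨x, hx⟩), by simp⟩

theorem card_entries_le {n : ℕ} (a : Fin n → X) : (entries a).card ≤ n := by
  exact Finset.card_image_le.trans (by simp)

theorem entries_nonempty {n : ℕ} (a : Fin (n + 1) → X) : (entries a).Nonempty :=
  ⟨a 0, mem_entries.2 ⟨0, rfl⟩⟩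

theorem entries_comp_subset {n m : ℕ} (a : Fin n → X) (i : Fin m → Fin n) :
    entries (a ∘ i) ⊆ entries a := by
  intro x hx
  obtain ⟨l, rfl⟩ := mem_entries.1 hx
  exact mem_entries.2 ⟨i l, rfl⟩

theorem exists_comp_eq {n m : ℕ} {a : Fin n → X} {b : Fin m → X} (h : entries b ⊆ entries a) :
    ∃ i : Fin m → Fin n, a ∘ i = b := by
  choose i hi using fun l => mem_entries.1 (h (mem_entries.2 ⟨l, rfl⟩))
  exact ⟨i, funext hi⟩

variable [Fintype A] {k : ℕ} {p : (V : Finset X) → (V → A) → ℚ}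
  {q : (c : Constraint L X) → (c.vars → A) → ℚ}

/-- The distribution on `Aⁿ` that a solution assigns to a tuple. -/
noncomputable def tupleWeight (p : (V : Finset X) → (V → A) → ℚ) {n : ℕ} (a : Fin n → X) :
    (Fin n → A) → ℚ :=
  pushforward (evalTuple a subset_rfl) (p (entries a))

/-- The distribution on `Aⁿ` that a solution assigns to a constraint. -/
noncomputable def constraintWeight (q : (c : Constraint L X) → (c.vars → A) → ℚ) {n : ℕ}
    (R : L.Relations n) (t : Fin n → X) (f : Fin n → A) : ℚ :=
  if h : Structure.RelMap R t then
    pushforward (evalTuple t (entries_tuple ⟨n, R, t, h⟩).subset) (q ⟨n, R, t, h⟩) f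
  else 0

theorem pushforward_mem_Icc {α β : Type*} [Fintype α] [Fintype β] {φ : α → β} {w : α → ℚ}
    (hw : ∀ a, 0 ≤ w a) (h1 : ∑ a, w a = 1) (b : β) : pushforward φ w b ∈ Set.Icc (0 : ℚ) 1 := by
  refine ⟨pushforward_nonneg hw b, ?_⟩
  rw [← h1, ← sum_pushforward φ w]
  exact Finset.single_le_sum (fun b _ => pushforward_nonneg hw b) (Finset.mem_univ b)

theorem pushforward_evalTuple_eq {n : ℕ} {V : Finset X} {a : Fin n → X} {h : entries a ⊆ V}
    {w : (V → A) → ℚ} {f : Fin n → A} (hf : pushforward (evalTuple a h) w f ≠ 0) {i i' : Fin n}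
    (hi : a i = a i') : f i = f i' := by
  obtain ⟨g, rfl, -⟩ := exists_of_pushforward_ne_zero hf
  simp [evalTuple, hi]

theorem constraintWeight_eq {A : Type*} [Fintype A] {q : (c : Constraint L X) → (c.vars → A) → ℚ}
    {n : ℕ} {R : L.Relations n} {t : Fin n → X} {f : Fin n → A}
    (h : constraintWeight q R t f ≠ 0) {i i' : Fin n} (hi : t i = t i') : f i = f i' := by
  unfold constraintWeight at h
  split_ifs at h with ht
  · exact pushforward_evalTuple_eq h hi
  · exact absurd rfl h

namespace IsSASolution

variable (hs : IsSASolution k p q)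
include hs

theorem sum_tupleWeight (j : Fin k) (a : Fin (j + 1) → X) : ∑ f, tupleWeight p a f = 1 := by
  rw [tupleWeight, sum_pushforward]
  exact hs.sum_one _ (entries_nonempty a) ((card_entries_le a).trans j.2)

theorem tupleWeight_mem_Icc (j : Fin k) (a : Fin (j + 1) → X) (f : Fin (j + 1) → A) :
    tupleWeight p a f ∈ Set.Icc (0 : ℚ) 1 :=
  pushforward_mem_Icc
    (fun g => (hs.p_range _ (entries_nonempty a) ((card_entries_le a).trans j.2) g).1)
    (hs.sum_one _ (entries_nonempty a) ((card_entries_le a).trans j.2)) f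

theorem pushforward_tupleWeight (j j' : Fin k) (a : Fin (j + 1) → X)
    (i : Fin (j' + 1) → Fin (j + 1)) :
    pushforward (fun f => f ∘ i) (tupleWeight p a) = tupleWeight p (a ∘ i) := by
  rw [tupleWeight, tupleWeight, pushforward_pushforward]
  have : p (entries (a ∘ i)) =
      pushforward (restrictFun (entries_comp_subset a i)) (p (entries a)) :=
    funext fun f => (hs.marginal _ _ (entries_comp_subset a i) (entries_nonempty _)
      ((card_entries_le a).trans j.2) f).trans (Finset.sum_congr (by ext; simp) fun _ _ => rfl)
  rw [this, pushforward_pushforward]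
  rfl

theorem pushforward_constraintWeight {n : ℕ} (R : L.Relations n) (t : Fin n → X)
    (ht : Structure.RelMap R t) (j : Fin k) (i : Fin (j + 1) → Fin n) :
    pushforward (fun f => f ∘ i) (constraintWeight q R t) = tupleWeight p (t ∘ i) := by
  have hw : constraintWeight q R t =
    pushforward (evalTuple t (entries_tuple ⟨n, R, t, ht⟩).subset) (q ⟨n, R, t, ht⟩) :=
    funext fun f => by simp [constraintWeight, ht]
  rw [hw, tupleWeight, pushforward_pushforward]
  have : p (entries (t ∘ i)) = pushforward
      (restrictFun ((entries_comp_subset t i).trans (entries_tuple ⟨n, R, t, ht⟩).subset))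
      (q ⟨n, R, t, ht⟩) :=
    funext fun f => (hs.constraint_marginal ⟨n, R, t, ht⟩ _
      ((entries_comp_subset t i).trans (entries_tuple ⟨n, R, t, ht⟩).subset) (entries_nonempty _)
      ((card_entries_le _).trans j.2) f).trans (Finset.sum_congr (by ext; simp) fun _ _ => rfl)
  rw [this, pushforward_pushforward]
  rfl

theorem relMap_of_constraintWeight_ne_zero {n : ℕ} {R : L.Relations n} {t : Fin n → X}
    {f : Fin n → A} (h : constraintWeight q R t f ≠ 0) : Structure.RelMap R f := by
  unfold constraintWeight at h
  split_ifs at h with ht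
  · obtain ⟨g, rfl, hg⟩ := exists_of_pushforward_ne_zero h
    by_contra hn
    exact hg (hs.constraint_support ⟨n, R, t, ht⟩ g hn)
  · exact absurd rfl h

theorem constraintWeight_mem_Icc {n : ℕ} (R : L.Relations n) (t : Fin n → X)
    (f : Fin n → A) : constraintWeight q R t f ∈ Set.Icc (0 : ℚ) 1 := by
  unfold constraintWeight
  split_ifs with ht
  · by_cases hf : ∃ g, evalTuple t (entries_tuple ⟨n, R, t, ht⟩).subset g = f
    · obtain ⟨g, rfl⟩ := hf
      have : pushforward (evalTuple t (entries_tuple ⟨n, R, t, ht⟩).subset)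
          (q ⟨n, R, t, ht⟩) (evalTuple t (entries_tuple ⟨n, R, t, ht⟩).subset g) = q ⟨n, R, t, ht⟩ g := by
        have hinj := evalTuple_injective (A := A) (entries_tuple ⟨n, R, t, ht⟩)
        simp [pushforward, hinj.eq_iff, Finset.filter_eq']
      rw [this]
      exact hs.q_range _ g
    · have : pushforward (evalTuple t (entries_tuple ⟨n, R, t, ht⟩).subset)
          (q ⟨n, R, t, ht⟩) f = 0 := by
        by_contra hne
        obtain ⟨g, hg, -⟩ := exists_of_pushforward_ne_zero hne
        exact hf ⟨g, hg⟩
      rw [this]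
      simp
  · simp

end IsSASolution

/-- Solutions of the Sherali–Adams system can be averaged along tuple classes. -/
theorem TupleClasses.saFeasible [Finite X] (T : TupleClasses L k X X')
    (h : SAFeasible L k X A) : SAFeasible L k X' A := by
  obtain ⟨p, q, hs⟩ := h
  choose len enum henum using fun V : {V : Finset X' // V.Nonempty ∧ V.card ≤ k} =>
    exists_entries_eq V.2.1 V.2.2
  let p' : (V : Finset X') → (V → A) → ℚ := fun V f =>
    if hV : V.Nonempty ∧ V.card ≤ k then
      average (T.tuples (len ⟨V, hV⟩) (enum ⟨V, hV⟩)) fun a =>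
        tupleWeight p a (evalTuple (enum ⟨V, hV⟩) (henum ⟨V, hV⟩).subset f)
    else 0
  let q' : (c : Constraint L X') → (c.vars → A) → ℚ := fun c f =>
    average (T.constraints c) fun t => constraintWeight q c.symb t (evalTuple c.tuple (entries_tuple c).subset f)
  have hp' : ∀ (V : Finset X') (hV : V.Nonempty ∧ V.card ≤ k) (f : V → A), p' V f =
      average (T.tuples (len ⟨V, hV⟩) (enum ⟨V, hV⟩)) fun a =>
        tupleWeight p a (evalTuple (enum ⟨V, hV⟩) (henum ⟨V, hV⟩).subset f) :=
    fun V hV f => dif_pos hV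
  have hsupp : ∀ (j : Fin k) (a' : Fin (j + 1) → X') (V : Finset X') (hV : entries a' = V)
      (a : Fin (j + 1) → X), a ∈ T.tuples j a' → ∀ f, tupleWeight p a f ≠ 0 →
      f ∈ Set.range (evalTuple (A := A) a' hV.subset) := fun j a' V hV a ha f hf =>
    mem_range_evalTuple hV fun i i' hi =>
      pushforward_evalTuple_eq hf (T.tuples_eq j a' a ha i i' hi)
  refine ⟨p', q', ?_, ?_, ?_, ?_, ?_, ?_⟩
  · intro V h₁ h₂ f
    rw [hp' V ⟨h₁, h₂⟩]
    exact average_mem_Icc fun a _ => hs.tupleWeight_mem_Icc _ _ _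
  · intro c f
    exact average_mem_Icc fun t _ => hs.constraintWeight_mem_Icc _ _ _
  · intro V h₁ h₂
    simp only [hp' V ⟨h₁, h₂⟩]
    rw [sum_average]
    refine average_eq_of_forall (T.tuples_nonempty _ _) fun a ha => ?_
    have := sum_comp_eq_pushforward (evalTuple_injective (A := A) (henum ⟨V, h₁, h₂⟩))
      (hsupp _ _ _ (henum ⟨V, h₁, h₂⟩) a ha) (fun _ => ()) () (fun _ => True) (by simp)
    rw [Finset.filter_true] at this
    rw [this, ← hs.sum_tupleWeight _ a]
    simp [pushforward]
  · intro U V hUV hU hV f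
    have hU' : U.Nonempty ∧ U.card ≤ k := ⟨hU, (Finset.card_le_card hUV).trans hV⟩
    have hV' : V.Nonempty ∧ V.card ≤ k := ⟨hU.mono hUV, hV⟩
    obtain ⟨i, hi⟩ := exists_comp_eq (a := enum ⟨V, hV'⟩) (b := enum ⟨U, hU'⟩)
      (by rw [henum, henum]; exact hUV)
    simp only [hp' U hU', hp' V hV']
    rw [sum_average, ← average_comp (T.tuples_nonempty (len ⟨V, hV'⟩) (enum ⟨V, hV'⟩))
      (fun a => a ∘ i)]
    · refine average_congr fun a ha => ?_
      rw [← hs.pushforward_tupleWeight]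
      refine (sum_comp_eq_pushforward (evalTuple_injective (A := A) (henum ⟨V, hV'⟩))
        (hsupp _ _ _ (henum ⟨V, hV'⟩) a ha) _ _ _ fun g => ?_).symm
      rw [← (evalTuple_injective (A := A) (henum ⟨U, hU'⟩)).eq_iff]
      simp [funext_iff, evalTuple, restrictFun, ← hi]
    · intro a ha
      rw [← hi]
      exact T.tuples_comp _ _ _ a ha i
    · rw [← hi]
      exact fun b₁ h₁ b₂ h₂ => T.tuples_fibre _ _ _ i b₁ b₂ h₁ h₂
  · intro c U hUc hU hUk f
    have hU' : U.Nonempty ∧ U.card ≤ k := ⟨hU, hUk⟩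
    obtain ⟨i, hi⟩ := exists_comp_eq (a := c.tuple) (b := enum ⟨U, hU'⟩)
      (by rw [henum]; exact hUc)
    simp only [hp' U hU', q']
    rw [sum_average, ← average_comp (T.constraints_nonempty c) (fun a => a ∘ i)]
    · refine average_congr fun t ht => ?_
      rw [← hs.pushforward_constraintWeight c.symb t (T.constraints_holds c t ht)]
      refine (sum_comp_eq_pushforward (evalTuple_injective (A := A) (entries_tuple c))
        (fun g hg => mem_range_evalTuple (entries_tuple c) fun i i' hi =>
          constraintWeight_eq hg (T.constraints_eq c t ht i i' hi)) _ _ _ fun g => ?_).symm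
      rw [← (evalTuple_injective (A := A) (henum ⟨U, hU'⟩)).eq_iff]
      simp [funext_iff, evalTuple, restrictFun, ← hi]
    · intro t ht
      rw [← hi]
      exact T.constraints_comp c _ t ht i
    · rw [← hi]
      exact fun b₁ h₁ b₂ h₂ => T.constraints_fibre c _ i b₁ b₂ h₁ h₂
  · intro c f hf
    refine average_eq_of_forall (T.constraints_nonempty c) fun t _ => ?_
    by_contra hne
    exact hf (hs.relMap_of_constraintWeight_ne_zero hne)

end Transfer

section ClassesOne

variable {L : FirstOrder.Language.{u, v}} [Finite (Σ n, L.Relations n)] {X : Type*} {X' : Type*}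
  [L.Structure X] [L.Structure X'] [Finite X] [Finite X']

/-- The classes of elements and constraints with the same iterated degrees. -/
def EqWLOne.tupleClasses [IsEmpty (L.Relations 0)] (h : EqWLOne L X X') :
    TupleClasses L 1 X X' where
  tuples _ a' := {a | ∀ i, SameDegree (L := L) (Sum.inl (a i)) (Sum.inl (a' i))}
  constraints c' := {t | ∃ ht : Structure.RelMap c'.symb t,
    SameDegree (Sum.inr ⟨c'.arity, c'.symb, t, ht⟩) (Sum.inr c')}
  tuples_nonempty _ a' := by
    choose a ha using fun i => h.exists_sameDegree_inl (a' i)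
    exact ⟨a, ha⟩
  constraints_nonempty := by
    rintro ⟨n, R, t', ht'⟩
    obtain ⟨c, hc⟩ := h.exists_sameDegree_inr ⟨n, R, t', ht'⟩
    obtain _ | n := n
    · exact (IsEmpty.false R).elim
    · obtain ⟨t, ht, rfl⟩ := hc.exists_eq_mk 0
      exact ⟨t, ht, hc⟩
  tuples_eq j a' a _ i i' _ := by
    obtain rfl := Subsingleton.elim j 0
    exact congrArg a (Subsingleton.elim (α := Fin 1) i i')
  constraints_eq := by
    rintro ⟨n, R, t', ht'⟩ t ⟨ht, hc⟩ i i' hi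
    exact (hc.entry_eq_iff i i').2 hi
  constraints_holds := by
    rintro c' t ⟨ht, -⟩
    exact ht
  tuples_comp _ _ _ _ ha i l := ha (i l)
  constraints_comp := by
    rintro ⟨n, R, t', ht'⟩ j t ⟨ht, hc⟩ i l
    exact hc.entry (i l)
  tuples_fibre j j' a' i b₁ b₂ h₁ h₂ := by
    obtain rfl := Subsingleton.elim j 0
    obtain rfl := Subsingleton.elim j' 0
    obtain rfl : i = id := funext fun l => Subsingleton.elim (α := Fin 1) _ _
    have key : ∀ b : Fin 1 → X, (∀ l, SameDegree (L := L) (Sum.inl (b l)) (Sum.inl (a' l))) →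
        {a : Fin 1 → X | (∀ l, SameDegree (L := L) (Sum.inl (a l)) (Sum.inl (a' l))) ∧
          a ∘ id = b}.ncard = 1 := by
      intro b hb
      rw [Set.ncard_eq_one]
      refine ⟨b, Set.ext fun a => ⟨fun ha => ha.2, ?_⟩⟩
      rintro rfl
      exact ⟨hb, rfl⟩
    exact (key b₁ h₁).trans (key b₂ h₂).symm
  constraints_fibre := by
    rintro ⟨n, R, t', ht'⟩ j i b₁ b₂ h₁ h₂
    obtain rfl := Subsingleton.elim j 0
    have key := SameDegree.ncard_eq ((h₁ 0).trans (h₂ 0).symm) R (i 0)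
      (fun t => ∃ ht : Structure.RelMap R t,
        SameDegree (Sum.inr ⟨n, R, t, ht⟩) (Sum.inr ⟨n, R, t', ht'⟩))
      (fun t₁ t₂ r₁ r₂ h₁₂ ⟨_, h₁⟩ => ⟨r₂, h₁₂.symm.trans h₁⟩)
    have hset : ∀ b : Fin 1 → X, {t | Structure.RelMap R t ∧ t (i 0) = b 0 ∧
        ∃ ht : Structure.RelMap R t,
          SameDegree (Sum.inr ⟨n, R, t, ht⟩) (Sum.inr ⟨n, R, t', ht'⟩)} =
        {t | (∃ ht : Structure.RelMap R t,
          SameDegree (Sum.inr ⟨n, R, t, ht⟩) (Sum.inr ⟨n, R, t', ht'⟩)) ∧ t ∘ i = b} := by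
      refine fun b => Set.ext fun t => ⟨?_, ?_⟩
      · rintro ⟨-, hb, ht⟩
        refine ⟨ht, funext fun l => ?_⟩
        obtain rfl := Subsingleton.elim (α := Fin 1) l 0
        exact hb
      · rintro ⟨⟨ht, hd⟩, rfl⟩
        exact ⟨ht, rfl, ht, hd⟩
    exact (congrArg Set.ncard (hset b₁)).symm.trans (key.trans (congrArg Set.ncard (hset b₂)))

end ClassesOne

section ClassesStar

variable {L : FirstOrder.Language.{u, v}} {k : ℕ} {X : Type*} {X' : Type*}
  [L.Structure X] [L.Structure X']

variable (L) in
/-- A tuple as an element of `X*ₖ`. -/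
def Star.ofTuple (j : Fin k) (a : Fin (j + 1) → X) : Star L k X := Sum.inl ⟨j, a⟩

variable (k) in
/-- A constraint as an element of `X*ₖ`. -/
def Star.ofConstraint (c : Constraint L X) : Star L k X := Sum.inr c

theorem Star.ofTuple_injective (j : Fin k) :
    Function.Injective (Star.ofTuple L (X := X) j) := by
  intro a b h
  exact eq_of_heq (Sigma.mk.inj (Sum.inl_injective h)).2

theorem Star.ofConstraint_injective :
    Function.Injective (Star.ofConstraint (L := L) (X := X) k) := fun _ _ h =>
  Sum.inr_injective h

/-- The relation symbols of `X*ₖ`, as symbols of its signature. -/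
abbrev starSymbol {m : ℕ} (R : StarSymbol L k m) : (starLanguage L k).Relations m := R

variable [Finite (Σ n, L.Relations n)] [Finite X] [Finite X']

theorem SameDegree.exists_ofTuple {y : Star L k X} {j : Fin k} {a' : Fin (j + 1) → X'}
    (h : SameDegree (L := starLanguage L k) (Sum.inl y) (Sum.inl (Star.ofTuple L j a')))
    (S : Set (Fin (j + 1))) (hS : ∀ i ∈ S, ∀ i' ∈ S, a' i = a' i') :
    ∃ a, y = Star.ofTuple L j a ∧ ∀ i ∈ S, ∀ i' ∈ S, a i = a i' := by
  obtain ⟨t, ⟨a, ha, h0⟩, hk, -⟩ := exists_constraint_of_iterDegree_eq (j := 0) (h 1)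
    (starSymbol (StarSymbol.tupleEq j S)) (fun _ => Star.ofTuple L j a') ⟨a', hS, rfl⟩ (i := 0) rfl
  exact ⟨a, ((hk 0).2 rfl).symm.trans h0, ha⟩

theorem SameDegree.exists_ofConstraint {y : Star L k X} {n : ℕ} {R : L.Relations n}
    {t' : Fin n → X'} {ht' : Structure.RelMap R t'}
    (h : SameDegree (L := starLanguage L k) (Sum.inl y)
      (Sum.inl (Star.ofConstraint k ⟨n, R, t', ht'⟩)))
    (S : Set (Fin n)) (hS : ∀ i ∈ S, ∀ i' ∈ S, t' i = t' i') :
    ∃ t, ∃ ht : Structure.RelMap R t, y = Star.ofConstraint k ⟨n, R, t, ht⟩ ∧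
      ∀ i ∈ S, ∀ i' ∈ S, t i = t i' := by
  obtain ⟨s, ⟨t, ht, heq, h0⟩, hk, -⟩ := exists_constraint_of_iterDegree_eq (j := 0) (h 1)
    (starSymbol (StarSymbol.constraintEq R S)) (fun _ => Star.ofConstraint k ⟨n, R, t', ht'⟩)
    ⟨t', ht', hS, rfl⟩ (i := 0) rfl
  exact ⟨t, ht, ((hk 0).2 rfl).symm.trans h0, heq⟩

theorem SameDegree.ofTuple_eq {j : Fin k} {a : Fin (j + 1) → X} {a' : Fin (j + 1) → X'}
    (h : SameDegree (L := starLanguage L k) (Sum.inl (Star.ofTuple L j a))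
      (Sum.inl (Star.ofTuple L j a')))
    {i i' : Fin (j + 1)} (hi : a' i = a' i') : a i = a i' := by
  obtain ⟨b, hb, he⟩ := h.exists_ofTuple {i, i'} (by simp [hi])
  obtain rfl := Star.ofTuple_injective j hb
  exact he i (by simp) i' (by simp)

theorem SameDegree.ofConstraint_eq {n : ℕ} {R : L.Relations n} {t : Fin n → X}
    {ht : Structure.RelMap R t} {t' : Fin n → X'} {ht' : Structure.RelMap R t'}
    (h : SameDegree (L := starLanguage L k) (Sum.inl (Star.ofConstraint k ⟨n, R, t, ht⟩))
      (Sum.inl (Star.ofConstraint k ⟨n, R, t', ht'⟩)))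
    {i i' : Fin n} (hi : t' i = t' i') : t i = t i' := by
  obtain ⟨s, hs, hb, he⟩ := h.exists_ofConstraint {i, i'} (by simp [hi])
  cases Star.ofConstraint_injective hb
  exact he i (by simp) i' (by simp)

theorem SameDegree.ofTuple_comp {j j' : Fin k} {a : Fin (j + 1) → X} {a' : Fin (j + 1) → X'}
    (h : SameDegree (L := starLanguage L k) (Sum.inl (Star.ofTuple L j a))
      (Sum.inl (Star.ofTuple L j a')))
    (i : Fin (j' + 1) → Fin (j + 1)) :
    SameDegree (L := starLanguage L k) (Sum.inl (Star.ofTuple L j' (a ∘ i)))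
      (Sum.inl (Star.ofTuple L j' (a' ∘ i))) := by
  intro J
  obtain ⟨t, ht, hk, hd⟩ := exists_constraint_of_iterDegree_eq (j := J + 1) (h (J + 2))
    (starSymbol (StarSymbol.tupleProj j j' i)) ![Star.ofTuple L j a', Star.ofTuple L j' (a' ∘ i)]
    ⟨a', rfl, rfl⟩ (i := 0) rfl
  obtain ⟨s, hs, he, -, hd'⟩ := exists_entry_of_iterDegree_eq hd 1
  cases he
  obtain ⟨x, h0, h1⟩ := ht
  obtain rfl := Star.ofTuple_injective j (((hk 0).2 rfl).symm.trans h0)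
  rw [h1] at hd'
  exact hd'

theorem SameDegree.ofConstraint_comp {n : ℕ} {R : L.Relations n} {t : Fin n → X}
    {ht : Structure.RelMap R t} {t' : Fin n → X'} {ht' : Structure.RelMap R t'}
    (h : SameDegree (L := starLanguage L k) (Sum.inl (Star.ofConstraint k ⟨n, R, t, ht⟩))
      (Sum.inl (Star.ofConstraint k ⟨n, R, t', ht'⟩)))
    {j : Fin k} (i : Fin (j + 1) → Fin n) :
    SameDegree (L := starLanguage L k) (Sum.inl (Star.ofTuple L j (t ∘ i)))
      (Sum.inl (Star.ofTuple L j (t' ∘ i))) := by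
  intro J
  obtain ⟨s, hs, hk, hd⟩ := exists_constraint_of_iterDegree_eq (j := J + 1) (h (J + 2))
    (starSymbol (StarSymbol.constraintProj R j i))
    ![Star.ofConstraint k ⟨n, R, t', ht'⟩, Star.ofTuple L j (t' ∘ i)] ⟨t', ht', rfl, rfl⟩ (i := 0) rfl
  obtain ⟨s', hs', he, -, hd'⟩ := exists_entry_of_iterDegree_eq hd 1
  cases he
  obtain ⟨x, hx, h0, h1⟩ := hs
  cases Star.ofConstraint_injective (((hk 0).2 rfl).symm.trans h0)
  rw [h1] at hd'
  exact hd'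

theorem SameDegree.ncard_ofTuple_comp {j j' : Fin k} (a' : Fin (j + 1) → X')
    (i : Fin (j' + 1) → Fin (j + 1)) {b₁ b₂ : Fin (j' + 1) → X}
    (h : SameDegree (L := starLanguage L k) (Sum.inl (Star.ofTuple L j' b₁))
      (Sum.inl (Star.ofTuple L j' b₂))) :
    {a | SameDegree (L := starLanguage L k) (Sum.inl (Star.ofTuple L j a))
      (Sum.inl (Star.ofTuple L j a')) ∧ a ∘ i = b₁}.ncard =
    {a | SameDegree (L := starLanguage L k) (Sum.inl (Star.ofTuple L j a))
      (Sum.inl (Star.ofTuple L j a')) ∧ a ∘ i = b₂}.ncard := by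
  have hcard : ∀ b : Fin (j' + 1) → X,
      {a | SameDegree (L := starLanguage L k) (Sum.inl (Star.ofTuple L j a))
        (Sum.inl (Star.ofTuple L j a')) ∧ a ∘ i = b}.ncard =
      {t : Fin 2 → Star L k X | Structure.RelMap (starSymbol (L := L) (StarSymbol.tupleProj j j' i)) t ∧
        t 1 = Star.ofTuple L j' b ∧ SameDegree (L := starLanguage L k) (Sum.inl (t 0))
          (Sum.inl (Star.ofTuple L j a'))}.ncard := by
    intro b
    refine Set.ncard_congr (fun a _ => ![Star.ofTuple L j a, Star.ofTuple L j' (a ∘ i)]) ?_ ?_ ?_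
    · rintro a ⟨ha, rfl⟩
      exact ⟨⟨a, rfl, rfl⟩, rfl, ha⟩
    · intro a₁ a₂ _ _ he
      exact Star.ofTuple_injective j (congrFun he 0)
    · rintro t ⟨⟨a, h0, h1⟩, hb, ha⟩
      refine ⟨a, ⟨?_, Star.ofTuple_injective j' (h1.symm.trans hb)⟩, ?_⟩
      · rw [h0] at ha
        exact ha
      · funext l
        fin_cases l
        · exact h0.symm
        · exact h1.symm
  rw [hcard, hcard]
  exact h.ncard_eq _ _ _ fun t₁ t₂ _ _ h₁₂ h₁ => (h₁₂.entry 0).symm.trans h₁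

theorem SameDegree.ncard_ofConstraint_comp {n : ℕ} {R : L.Relations n} {t' : Fin n → X'}
    (ht' : Structure.RelMap R t') {j : Fin k} (i : Fin (j + 1) → Fin n) {b₁ b₂ : Fin (j + 1) → X}
    (h : SameDegree (L := starLanguage L k) (Sum.inl (Star.ofTuple L j b₁))
      (Sum.inl (Star.ofTuple L j b₂))) :
    {t | (∃ ht : Structure.RelMap R t, SameDegree (L := starLanguage L k)
      (Sum.inl (Star.ofConstraint k ⟨n, R, t, ht⟩))
      (Sum.inl (Star.ofConstraint k ⟨n, R, t', ht'⟩))) ∧ t ∘ i = b₁}.ncard =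
    {t | (∃ ht : Structure.RelMap R t, SameDegree (L := starLanguage L k)
      (Sum.inl (Star.ofConstraint k ⟨n, R, t, ht⟩))
      (Sum.inl (Star.ofConstraint k ⟨n, R, t', ht'⟩))) ∧ t ∘ i = b₂}.ncard := by
  have hcard : ∀ b : Fin (j + 1) → X,
      {t | (∃ ht : Structure.RelMap R t, SameDegree (L := starLanguage L k)
        (Sum.inl (Star.ofConstraint k ⟨n, R, t, ht⟩))
        (Sum.inl (Star.ofConstraint k ⟨n, R, t', ht'⟩))) ∧ t ∘ i = b}.ncard =
      {s : Fin 2 → Star L k X |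
        Structure.RelMap (starSymbol (StarSymbol.constraintProj R j i)) s ∧
        s 1 = Star.ofTuple L j b ∧ SameDegree (L := starLanguage L k) (Sum.inl (s 0))
          (Sum.inl (Star.ofConstraint k ⟨n, R, t', ht'⟩))}.ncard := by
    intro b
    refine Set.ncard_congr
      (fun t ht => ![Star.ofConstraint k ⟨n, R, t, ht.1.1⟩, Star.ofTuple L j (t ∘ i)]) ?_ ?_ ?_
    · rintro t ⟨⟨ht, hd⟩, rfl⟩
      exact ⟨⟨t, ht, rfl, rfl⟩, rfl, hd⟩
    · intro t₁ t₂ _ _ he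
      cases Star.ofConstraint_injective (congrFun he 0)
      rfl
    · rintro s ⟨⟨t, ht, h0, h1⟩, hb, hd⟩
      refine ⟨t, ⟨⟨ht, ?_⟩, Star.ofTuple_injective j (h1.symm.trans hb)⟩, ?_⟩
      · rw [h0] at hd
        exact hd
      · funext l
        fin_cases l
        · exact h0.symm
        · exact h1.symm
  rw [hcard, hcard]
  exact h.ncard_eq _ _ _ fun t₁ t₂ _ _ h₁₂ h₁ => (h₁₂.entry 0).symm.trans h₁

/-- The classes of tuples and constraints with the same iterated degrees in `X*ₖ`. -/
def EqWLOne.starTupleClasses (h : EqWLOne (starLanguage L k) (Star L k X) (Star L k X')) :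
    TupleClasses L k X X' where
  tuples j a' := {a | SameDegree (L := starLanguage L k) (Sum.inl (Star.ofTuple L j a))
    (Sum.inl (Star.ofTuple L j a'))}
  constraints c' := {t | ∃ ht : Structure.RelMap c'.symb t, SameDegree (L := starLanguage L k)
    (Sum.inl (Star.ofConstraint k ⟨c'.arity, c'.symb, t, ht⟩)) (Sum.inl (Star.ofConstraint k c'))}
  tuples_nonempty j a' := by
    obtain ⟨y, hy⟩ := h.exists_sameDegree_inl (Star.ofTuple L j a')
    obtain ⟨a, rfl, -⟩ := hy.exists_ofTuple ∅ (by simp)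
    exact ⟨a, hy⟩
  constraints_nonempty c' := by
    obtain ⟨y, hy⟩ := h.exists_sameDegree_inl (Star.ofConstraint k c')
    obtain ⟨t, ht, rfl, -⟩ := hy.exists_ofConstraint ∅ (by simp)
    exact ⟨t, ht, hy⟩
  tuples_eq _ _ _ ha _ _ hi := ha.ofTuple_eq hi
  constraints_eq := fun _ _ ⟨_, hd⟩ _ _ hi => hd.ofConstraint_eq hi
  constraints_holds := fun _ _ ⟨ht, _⟩ => ht
  tuples_comp _ _ _ _ ha i := ha.ofTuple_comp i
  constraints_comp := fun _ _ _ ⟨_, hd⟩ i => hd.ofConstraint_comp i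
  tuples_fibre _ _ a' i _ _ h₁ h₂ := SameDegree.ncard_ofTuple_comp a' i (h₁.trans h₂.symm)
  constraints_fibre c' _ i _ _ h₁ h₂ :=
    SameDegree.ncard_ofConstraint_comp c'.holds i (h₁.trans h₂.symm)

end ClassesStar

variable {L : FirstOrder.Language.{u, v}} [Finite (Σ n, L.Relations n)] {k : ℕ} {X : Type*}
  {X' : Type*} [L.Structure X] [L.Structure X'] [Finite X] [Finite X']

theorem EqWL.symm (h : EqWL L k X X') : EqWL L k X' X :=
  h.imp (fun h => ⟨h.1, h.2.symm⟩) (fun h => ⟨h.1, h.2.symm⟩)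

theorem EqWL.saFeasible [IsEmpty (L.Relations 0)] (h : EqWL L k X X') {A : Type*} [L.Structure A]
    [Fintype A] (hA : SAFeasible L k X A) : SAFeasible L k X' A := by
  obtain ⟨rfl, h⟩ | ⟨-, h⟩ := h
  · exact h.tupleClasses.saFeasible hA
  · exact h.starTupleClasses.saFeasible hA

end CSPHierarchy

theorem corollary7p6 {L : FirstOrder.Language.{u, v}} [L.IsRelational] [IsEmpty (L.Relations 0)]
    [Finite (Σ n, L.Relations n)] {k : ℕ} (hk : 1 ≤ k)
    {X : Type*} {X' : Type*} [L.Structure X] [L.Structure X'] [Finite X] [Finite X']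
    (hXX' : CSPHierarchy.EqWL L k X X')
    (A : Type*) [L.Structure A] [Fintype A] :
    CSPHierarchy.SAFeasible L k X A ↔ CSPHierarchy.SAFeasible L k X' A :=
  ⟨hXX'.saFeasible, hXX'.symm.saFeasible⟩
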